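/- Let $p$ be an odd prime. A group is called UCS if it has exactly one characteristic subgroup that is non-trivial and proper. For a group $G$, write $\Phi(G)$ for its Frattini subgroup; for a subgroup $N$ and $k\ge 1$ write $N^k$ for the subgroup generated by the $k$-th powers of elements of $N$. A subgroup $N$ of a $p$-group $G$ (with $p$ odd) is powerfully embedded in $G$ if $[N,G]\le N^p$. Let $G$ be a finite UCS $p$-group of exponent $p^2$. Then there exists a subgroup $H$ of $G$ such that (a) $H$ is powerfully embedded in $G$ and $\Phi(G)<H$ (strict inclusion), and (b) $H$ is minimal, with respect to inclusion, among the subgroups of $G$ satisfying (a). Moreover, for every subgroup $H$ satisfying (a) and (b) there exists a UCS subgroup $H_0\le G$ of exponent $p^2$ such that $G=H_0^{\times k}$ for some integer $k\ge 1$ and $H_0\Phi(G)=H$. Here $G=H_0^{\times k}$ means that there is an isomorphism from the $k$-fold direct power of $H_0$ onto $G$ which maps one of the $k$ coordinate factors identically onto the subgroup $H_0$. -/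

import Mathlib

open scoped Pointwise

/-- `G` is a UCS group: it has exactly one characteristic subgroup that is
non-trivial and proper. -/
def IsUCS (G : Type*) [Group G] : Prop :=
  ∃! N : Subgroup G, N.Characteristic ∧ N ≠ ⊥ ∧ N ≠ ⊤

/-- The subgroup `N^k` of `N` generated by the `k`-th powers of the elements of `N`
(regarded as a subgroup of the ambient group `G`). -/
def powerSubgroup {G : Type*} [Group G] (N : Subgroup G) (k : ℕ) : Subgroup G :=
  Subgroup.closure {y : G | ∃ x ∈ N, x ^ k = y}

/-- A subgroup `N` of a `p`-group `G` is powerfully embedded in `G` if `[N, G] ≤ N^p`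
when `p > 2` and `[N, G] ≤ N^4` when `p = 2`. -/
def IsPowerfullyEmbedded (p : ℕ) {G : Type*} [Group G] (N : Subgroup G) : Prop :=
  ⁅N, (⊤ : Subgroup G)⁆ ≤ powerSubgroup N (if p = 2 then 4 else p)

open scoped commutatorElement

/-! Write Z for the Frattini subgroup. The UCS property forces Z to be central, to contain all
commutators, and to be both kernel and image of the endomorphism x ↦ x^p. Hence G/Z ≅ Z, and the
commutator becomes a bilinear product x^p · y^p = [x, y] on Z. Via K ↦ K^p, powerfully embedded
subgroups above Z correspond to nonzero ideals, so a minimal H gives a minimal ideal A.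

The sum of the images of A under Aut(G) is characteristic, hence Z, and an irredundant family of
these images has direct sum Z (`exists_iSupIndep_map`). A lifts to H₀ with H₀Z = H and H₀ ∩ Z = H₀^p
= A (`exists_isPowerSection`); the corresponding images of H₀ commute and multiply directly to G
(`exists_mulEquiv_pi`). That H₀ is UCS follows from a Schur-type dichotomy for its endomorphisms
(`bijective_or_forall_mem`). -/

theorem Subgroup.mem_of_pow_mem_of_coprime {G : Type*} [Group G] (M : Subgroup G) {x : G}
    {a b : ℤ} (ha : x ^ a ∈ M) (hb : x ^ b ∈ M) (hab : IsCoprime a b) : x ∈ M := by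
  obtain ⟨u, v, h⟩ := hab
  have h1 : x = (x ^ a) ^ u * (x ^ b) ^ v := by
    rw [← zpow_mul, ← zpow_mul, ← zpow_add, mul_comm a, mul_comm b, h, zpow_one]
  rw [h1]
  exact M.mul_mem (M.zpow_mem ha u) (M.zpow_mem hb v)

theorem mul_pow_of_central_commutator {G : Type*} [Group G] {x y c : G} (hc : ∀ g, Commute c g)
    (h : y * x = c * (x * y)) (n : ℕ) : (x * y) ^ n = c ^ (n.choose 2) * (x ^ n * y ^ n) := by
  have hy : ∀ n : ℕ, y ^ n * x = c ^ n * (x * y ^ n) := by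
    intro n
    induction n with
    | zero => simp
    | succ n ih =>
      calc y ^ (n + 1) * x = y ^ n * (y * x) := by rw [pow_succ, mul_assoc]
        _ = (y ^ n * c) * (x * y) := by rw [h, mul_assoc]
        _ = c * (y ^ n * x) * y := by rw [← (hc (y ^ n)).eq]; simp only [mul_assoc]
        _ = c ^ (n + 1) * (x * y ^ (n + 1)) := by
          rw [ih, pow_succ' c, pow_succ y]; simp only [mul_assoc]
  induction n with
  | zero => simp
  | succ n ih =>
    have h2 : (n + 1).choose 2 = n.choose 2 + n := by
      rw [Nat.choose_succ_succ' n 1, Nat.choose_one_right, add_comm]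
    calc (x * y) ^ (n + 1) = c ^ (n.choose 2) * (x ^ n * (y ^ n * x) * y) := by
          rw [pow_succ, ih]; simp only [mul_assoc]
      _ = c ^ (n.choose 2) * ((x ^ n * c ^ n) * (x * y ^ n * y)) := by
          rw [hy]; simp only [mul_assoc]
      _ = c ^ ((n + 1).choose 2) * (x ^ (n + 1) * y ^ (n + 1)) := by
          rw [← ((hc (x ^ n)).pow_left n).eq, h2, pow_add, pow_succ, pow_succ]
          simp only [mul_assoc]

theorem Subgroup.characteristic_of_forall_mem {G : Type*} [Group G] {M : Subgroup G}
    (h : ∀ (φ : G ≃* G), ∀ x ∈ M, φ x ∈ M) : M.Characteristic :=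
  Subgroup.characteristic_iff_le_comap.mpr fun φ x hx => h φ x hx

theorem Subgroup.Characteristic.apply_mem {G : Type*} [Group G] {M : Subgroup G}
    (h : M.Characteristic) (φ : G ≃* G) {x : G} (hx : x ∈ M) : φ x ∈ M :=
  Subgroup.characteristic_iff_le_comap.mp h φ hx

/-! ### Structure of UCS groups of exponent p² -/

/-- The structure of a UCS `p`-group of exponent `p ^ 2` with respect to its
characteristic subgroup `Z`: raising to the power `p` is an endomorphism whose kernel and
image are both equal to the central subgroup `Z`, which contains all commutators. -/
structure IsPowerUCS (p : ℕ) {G : Type*} [Group G] (Z : Subgroup G) : Prop where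
  commute : ∀ {z}, z ∈ Z → ∀ x, Commute z x
  commutator_mem : ∀ x y : G, ⁅x, y⁆ ∈ Z
  mul_pow : ∀ x y : G, (x * y) ^ p = x ^ p * y ^ p
  pow_eq_one_iff : ∀ {x : G}, x ^ p = 1 ↔ x ∈ Z
  pow_mem : ∀ x : G, x ^ p ∈ Z
  exists_pow_eq : ∀ {z}, z ∈ Z → ∃ x, x ^ p = z
  ne_bot : Z ≠ ⊥
  ne_top : Z ≠ ⊤
  characteristic : Z.Characteristic
  char_cases : ∀ {M : Subgroup G}, M.Characteristic → M = ⊥ ∨ M = Z ∨ M = ⊤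

/-- If a maximal (hence normal) M missed x^p, then M⟨x^p⟩ = G would give x^(1 - pk) ∈ M for some k.
As 1 - pk is prime to the order of x, this puts x in M. -/
theorem IsPGroup.pow_mem_frattini {p : ℕ} (hp : p.Prime) {G : Type*} [Group G] [Finite G]
    (hpG : IsPGroup p G) (x : G) : x ^ p ∈ frattini G := by
  have := Fact.mk hp
  have := hpG.isNilpotent
  have key : ∀ M : Subgroup G, IsCoatom M → x ^ p ∈ M := by
    intro M hM
    have hn : M.Normal := Subgroup.NormalizerCondition.normal_of_coatom M
      Group.normalizerCondition_of_isNilpotent hM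
    by_contra hx
    have htop : M ⊔ Subgroup.zpowers (x ^ p) = ⊤ :=
      hM.2 _ (lt_of_le_of_ne le_sup_left fun h =>
        hx (h ▸ (le_sup_right : _ ≤ M ⊔ _) (Subgroup.mem_zpowers _)))
    have hx' : x ∈ M ⊔ Subgroup.zpowers (x ^ p) := htop ▸ Subgroup.mem_top x
    obtain ⟨m, hm, _, ⟨k, rfl⟩, hmk⟩ := Subgroup.mem_sup_of_normal_left.mp hx'
    obtain ⟨n, hn⟩ := hpG x
    refine hx (M.pow_mem (M.mem_of_pow_mem_of_coprime (a := 1 - p * k) (b := p ^ n) ?_ ?_ ?_) p)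
    · have : x ^ (1 - p * k : ℤ) = m := by
        rw [zpow_sub, zpow_one, zpow_mul, zpow_natCast]
        exact (eq_mul_inv_of_mul_eq hmk).symm
      rwa [this]
    · have : x ^ ((p : ℤ) ^ n) = 1 := by exact_mod_cast hn
      rw [this]; exact M.one_mem
    · exact IsCoprime.pow_right ⟨1, k, by ring⟩
  rw [frattini, Order.radical]
  simp only [Subgroup.mem_iInf]
  exact fun M hM => key M hM

theorem IsUCS.isPowerUCS_frattini {p : ℕ} (hp : p.Prime) (hodd : Odd p)
    {G : Type*} [Group G] [Finite G] (hpG : IsPGroup p G)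
    (hG : IsUCS G) (hexp : Monoid.exponent G = p ^ 2) : IsPowerUCS p (frattini G) := by
  have := Fact.mk hp
  have := hpG.isNilpotent
  obtain ⟨N, ⟨hNc, hNb, hNt⟩, huniq⟩ := hG
  have hne : ∃ x : G, x ^ p ≠ 1 := by
    by_contra! h
    have := Monoid.exponent_dvd_of_forall_pow_eq_one h
    rw [hexp] at this
    have := Nat.le_of_dvd hp.pos this
    nlinarith [hp.two_le]
  obtain ⟨x₀, hx₀⟩ := hne
  have : Nontrivial G := ⟨_, _, hx₀⟩
  have hΦt : frattini G ≠ ⊤ := by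
    obtain ⟨M, hM, -⟩ := (eq_top_or_exists_le_coatom (⊥ : Subgroup G)).resolve_left bot_ne_top
    exact fun h => hM.1 (top_le_iff.mp (h ▸ frattini_le_coatom hM))
  have hΦb : frattini G ≠ ⊥ := fun h =>
    hx₀ (Subgroup.mem_bot.mp (h ▸ hpG.pow_mem_frattini hp x₀))
  have hΦN : frattini G = N := huniq _ ⟨inferInstance, hΦb, hΦt⟩
  have cases : ∀ {M : Subgroup G}, M.Characteristic → M = ⊥ ∨ M = frattini G ∨ M = ⊤ := by
    intro M hM
    by_cases h1 : M = ⊥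
    · exact Or.inl h1
    by_cases h2 : M = ⊤
    · exact Or.inr (Or.inr h2)
    exact Or.inr (Or.inl ((huniq M ⟨hM, h1, h2⟩).trans hΦN.symm))
  have hcenter : frattini G ≤ Subgroup.center G := by
    have hb : Subgroup.center G ≠ ⊥ := hpG.bot_lt_center.ne'
    rcases cases (M := Subgroup.center G) inferInstance with h | h | h
    · exact absurd h hb
    · exact h.ge
    · exact h ▸ le_top
  have hcomm : ∀ {z}, z ∈ frattini G → ∀ x, Commute z x := fun hz x =>
    ((Subgroup.mem_center_iff.mp (hcenter hz)) x).symm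
  have hcommutator : commutator G ≤ frattini G := by
    rcases cases (M := commutator G) inferInstance with h | h | h
    · exact h ▸ bot_le
    · exact h.le
    · exact absurd h (Group.IsSolvable.commutator_lt_top_of_nontrivial G).ne
  have hbr : ∀ x y : G, ⁅x, y⁆ ∈ frattini G := fun x y =>
    hcommutator (Subgroup.commutator_mem_commutator (Subgroup.mem_top x) (Subgroup.mem_top y))
  -- As the exponent is not p, `Ω` contains some `x₀ ^ p ≠ 1`; being characteristic, it is then all
  -- of the Frattini subgroup.
  have hpow1 : ∀ {z}, z ∈ frattini G → z ^ p = 1 := by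
    let Ω : Subgroup G :=
      { carrier := {z | z ∈ frattini G ∧ z ^ p = 1}
        one_mem' := ⟨Subgroup.one_mem _, one_pow p⟩
        mul_mem' := fun {a b} ha hb => ⟨Subgroup.mul_mem _ ha.1 hb.1, by
          rw [(hcomm ha.1 b).mul_pow, ha.2, hb.2, one_mul]⟩
        inv_mem' := fun {a} ha => ⟨Subgroup.inv_mem _ ha.1, by rw [inv_pow, ha.2, inv_one]⟩ }
    have hΩ : Ω.Characteristic := Subgroup.characteristic_of_forall_mem fun φ x hx =>
      ⟨Subgroup.Characteristic.apply_mem inferInstance φ hx.1, by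
        rw [← map_pow, hx.2, map_one]⟩
    intro z hz
    rcases cases hΩ with h | h | h
    · have h1 : (x₀ ^ p) ^ p = 1 := by
        rw [← pow_mul, ← sq, ← hexp]; exact Monoid.pow_exponent_eq_one x₀
      have h2 : x₀ ^ p ∈ Ω := ⟨hpG.pow_mem_frattini hp x₀, h1⟩
      exact absurd (Subgroup.mem_bot.mp (h ▸ h2)) hx₀
    · exact (h.ge hz : z ∈ Ω).2
    · exact (h.ge (Subgroup.mem_top z) : z ∈ Ω).2
  have hmul : ∀ x y : G, (x * y) ^ p = x ^ p * y ^ p := by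
    intro x y
    have h2 : 2 < p := lt_of_le_of_ne hp.two_le (by rintro rfl; exact absurd hodd (by decide))
    rw [mul_pow_of_central_commutator (c := ⁅y, x⁆) (hcomm (hbr y x))
      (by simp [commutatorElement_def, mul_assoc])]
    -- Oddness enters here: p divides p(p-1)/2, which kills the commutator factor.
    obtain ⟨m, hm⟩ := hp.dvd_choose_self two_ne_zero h2
    rw [hm, pow_mul, hpow1 (hbr y x), one_pow, one_mul]
  let F : G →* G := MonoidHom.mk' (fun x => x ^ p) hmul
  have hker : F.ker = frattini G := by
    have hc : F.ker.Characteristic := Subgroup.characteristic_of_forall_mem fun φ x hx => by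
      rw [MonoidHom.mem_ker] at hx ⊢
      change x ^ p = 1 at hx
      change φ x ^ p = 1
      rw [← map_pow, hx, map_one]
    rcases cases hc with h | h | h
    · refine absurd (le_bot_iff.mp (fun z hz => ?_)) hΦb
      rw [← h]
      exact hpow1 hz
    · exact h
    · exact absurd (h.ge (Subgroup.mem_top x₀) : x₀ ∈ F.ker) hx₀
  have hrange : F.range = frattini G := by
    have hc : F.range.Characteristic := Subgroup.characteristic_of_forall_mem fun φ x hx => by
      obtain ⟨y, rfl⟩ := hx
      exact ⟨φ y, (map_pow φ y p).symm⟩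
    have hle : F.range ≤ frattini G := by
      rintro _ ⟨y, rfl⟩
      exact hpG.pow_mem_frattini hp y
    rcases cases hc with h | h | h
    · exact absurd (Subgroup.mem_bot.mp (h ▸ (⟨x₀, rfl⟩ : F x₀ ∈ F.range))) hx₀
    · exact h
    · exact absurd (top_le_iff.mp (h ▸ hle)) hΦt
  exact
    { commute := hcomm
      commutator_mem := hbr
      mul_pow := hmul
      pow_eq_one_iff := fun {x} => by rw [← hker]; rfl
      pow_mem := hpG.pow_mem_frattini hp
      exists_pow_eq := fun {z} hz => by rw [← hrange] at hz; exact hz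
      ne_bot := hΦb
      ne_top := hΦt
      characteristic := inferInstance
      char_cases := cases }

namespace IsPowerUCS

variable {p : ℕ} {G : Type*} [Group G] {Z : Subgroup G}

/-- Raising to the power `p`, as an endomorphism. -/
def powHom (hZ : IsPowerUCS p Z) : G →* G := MonoidHom.mk' (fun x => x ^ p) hZ.mul_pow

@[simp] theorem powHom_apply (hZ : IsPowerUCS p Z) (x : G) : hZ.powHom x = x ^ p := rfl

theorem exists_eq_mul_of_pow_eq (hZ : IsPowerUCS p Z) {x y : G} (h : x ^ p = y ^ p) :
    ∃ c ∈ Z, x = y * c :=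
  ⟨y⁻¹ * x, hZ.pow_eq_one_iff.mp (by rw [hZ.mul_pow, inv_pow, h, inv_mul_cancel]), by group⟩

theorem commutatorElement_mul_left (hZ : IsPowerUCS p Z) (x y g : G) :
    ⁅x * y, g⁆ = ⁅x, g⁆ * ⁅y, g⁆ := by
  have h1 : ⁅x * y, g⁆ = x * ⁅y, g⁆ * (g * x⁻¹ * g⁻¹) := by
    simp [commutatorElement_def, mul_assoc]
  rw [h1, ← (hZ.commute (hZ.commutator_mem y g) x).eq, mul_assoc,
    (hZ.commute (hZ.commutator_mem y g) _).eq]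
  simp [commutatorElement_def, mul_assoc]

theorem commutatorElement_eq_one (hZ : IsPowerUCS p Z) {c : G} (hc : c ∈ Z) (g : G) :
    ⁅c, g⁆ = 1 := commutatorElement_eq_one_iff_commute.mpr (hZ.commute hc g)

theorem commutatorElement_mul_mem (hZ : IsPowerUCS p Z) {c : G} (hc : c ∈ Z) (x g : G) :
    ⁅x * c, g⁆ = ⁅x, g⁆ := by
  rw [hZ.commutatorElement_mul_left, hZ.commutatorElement_eq_one hc, mul_one]

end IsPowerUCS

/-! ### Ideals and powerfully embedded subgroups -/

/-- A subgroup `B` of `Z` is a power ideal if `g ^ p ∈ B` implies `⁅g, x⁆ ∈ B`. If `G` is a UCS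
group of exponent `p ^ 2`, these are the ideals of the algebra which the commutator map
induces on `G / Z ≅ Z`. -/
structure IsPowerIdeal (p : ℕ) {G : Type*} [Group G] (Z B : Subgroup G) : Prop where
  le : B ≤ Z
  commutator_mem : ∀ {g : G}, g ^ p ∈ B → ∀ x : G, ⁅g, x⁆ ∈ B

/-- A minimal nontrivial power ideal. -/
structure IsMinimalPowerIdeal (p : ℕ) {G : Type*} [Group G] (Z A : Subgroup G) : Prop
    extends IsPowerIdeal p Z A where
  ne_bot : A ≠ ⊥
  eq_bot_or_eq : ∀ {B : Subgroup G}, IsPowerIdeal p Z B → B ≤ A → B = ⊥ ∨ B = A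

theorem IsPowerIdeal.map {p : ℕ} {G : Type*} [Group G] {Z B : Subgroup G}
    (hB : IsPowerIdeal p Z B) (hZ : Z.Characteristic) (φ : G ≃* G) :
    IsPowerIdeal p Z (B.map φ.toMonoidHom) where
  le := by
    rintro _ ⟨b, hb, rfl⟩
    exact hZ.apply_mem φ (hB.le hb)
  commutator_mem := by
    rintro g ⟨b, hb, h⟩ x
    refine ⟨⁅φ.symm g, φ.symm x⁆, hB.commutator_mem ?_ _, ?_⟩
    · have : φ.symm g ^ p = b := by
        rw [← map_pow, MulEquiv.symm_apply_eq]; exact h.symm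
      rwa [this]
    · change φ _ = _
      rw [map_commutatorElement, φ.apply_symm_apply, φ.apply_symm_apply]

theorem IsPowerIdeal.inf {p : ℕ} {G : Type*} [Group G] {Z B C : Subgroup G}
    (hB : IsPowerIdeal p Z B) (hC : IsPowerIdeal p Z C) : IsPowerIdeal p Z (B ⊓ C) where
  le := inf_le_left.trans hB.le
  commutator_mem := fun hg x => ⟨hB.commutator_mem hg.1 x, hC.commutator_mem hg.2 x⟩

theorem IsPowerUCS.isPowerIdeal_iSup {p : ℕ} {G : Type*} [Group G] {Z : Subgroup G}
    (hZ : IsPowerUCS p Z) {ι : Sort*} {B : ι → Subgroup G} (hB : ∀ i, IsPowerIdeal p Z (B i)) :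
    IsPowerIdeal p Z (⨆ i, B i) where
  le := iSup_le fun i => (hB i).le
  commutator_mem := by
    -- Membership in Z is carried along so that both factors of a product have p-th roots u, v; any
    -- root of the product is uv up to Z, which commutators do not see.
    have key : ∀ z ∈ ⨆ i, B i, z ∈ Z ∧ ∀ g, g ^ p = z → ∀ x, ⁅g, x⁆ ∈ ⨆ i, B i := by
      intro z hz
      induction hz using Subgroup.iSup_induction' with
      | hp i z hz =>
        exact ⟨(hB i).le hz, fun g hg x =>
          (le_iSup B i) ((hB i).commutator_mem (hg ▸ hz) x)⟩
      | h1 =>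
        refine ⟨Z.one_mem, fun g hg x => ?_⟩
        rw [hZ.commutatorElement_eq_one (hZ.pow_eq_one_iff.mp hg)]
        exact Subgroup.one_mem _
      | hmul a b _ _ iha ihb =>
        refine ⟨Z.mul_mem iha.1 ihb.1, fun g hg x => ?_⟩
        obtain ⟨u, rfl⟩ := hZ.exists_pow_eq iha.1
        obtain ⟨v, rfl⟩ := hZ.exists_pow_eq ihb.1
        rw [← hZ.mul_pow] at hg
        obtain ⟨c, hc, rfl⟩ := hZ.exists_eq_mul_of_pow_eq hg
        rw [hZ.commutatorElement_mul_mem hc, hZ.commutatorElement_mul_left]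
        exact Subgroup.mul_mem _ (iha.2 u rfl x) (ihb.2 v rfl x)
    exact fun {g} hg x => (key _ hg).2 g rfl x

theorem IsPowerUCS.powerSubgroup_eq_map {p : ℕ} {G : Type*} [Group G] {Z : Subgroup G}
    (hZ : IsPowerUCS p Z) (K : Subgroup G) : powerSubgroup K p = K.map hZ.powHom :=
  Subgroup.closure_eq (K.map hZ.powHom)

theorem IsPowerUCS.isPowerfullyEmbedded_iff {p : ℕ} (hp : p ≠ 2) {G : Type*} [Group G]
    {Z : Subgroup G} (hZ : IsPowerUCS p Z) (K : Subgroup G) :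
    IsPowerfullyEmbedded p K ↔ ∀ x ∈ K, ∀ g : G, ∃ y ∈ K, y ^ p = ⁅x, g⁆ := by
  rw [IsPowerfullyEmbedded, if_neg hp, hZ.powerSubgroup_eq_map, Subgroup.commutator_le]
  exact ⟨fun h x hx g => h x hx g (Subgroup.mem_top g), fun h x hx g _ => h x hx g⟩

theorem IsPowerUCS.isPowerfullyEmbedded_top {p : ℕ} (hp : p ≠ 2) {G : Type*} [Group G]
    {Z : Subgroup G} (hZ : IsPowerUCS p Z) : IsPowerfullyEmbedded p (⊤ : Subgroup G) :=
  (hZ.isPowerfullyEmbedded_iff hp _).mpr fun x _ g =>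
    let ⟨y, hy⟩ := hZ.exists_pow_eq (hZ.commutator_mem x g)
    ⟨y, Subgroup.mem_top y, hy⟩

/-- Take A = H^p. Since H contains the kernel Z of the power map, it is the full preimage of A, and
a nontrivial ideal inside A pulls back to a competitor of H. -/
theorem IsPowerUCS.exists_isMinimalPowerIdeal {p : ℕ} (hp : p ≠ 2) {G : Type*} [Group G]
    {Z : Subgroup G} (hZ : IsPowerUCS p Z) {H : Subgroup G}
    (hH : Minimal (fun K : Subgroup G => IsPowerfullyEmbedded p K ∧ Z < K) H) :
    ∃ A : Subgroup G, IsMinimalPowerIdeal p Z A ∧ ∀ g, g ∈ H ↔ g ^ p ∈ A := by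
  have hemb := (hZ.isPowerfullyEmbedded_iff hp H).mp hH.1.1
  have hmem : ∀ g, g ∈ H ↔ g ^ p ∈ H.map hZ.powHom := by
    refine fun g => ⟨fun hg => ⟨g, hg, rfl⟩, ?_⟩
    rintro ⟨h, hh, hgh⟩
    obtain ⟨c, hc, rfl⟩ := hZ.exists_eq_mul_of_pow_eq (x := g) (y := h) hgh.symm
    exact H.mul_mem hh (hH.1.2.le hc)
  refine ⟨H.map hZ.powHom, ⟨⟨?_, ?_⟩, ?_, ?_⟩, hmem⟩
  · rintro _ ⟨h, -, rfl⟩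
    exact hZ.pow_mem h
  · exact fun hg x => hemb _ ((hmem _).mpr hg) x
  · obtain ⟨h, hh, hhZ⟩ := SetLike.exists_of_lt hH.1.2
    intro hbot
    exact hhZ (hZ.pow_eq_one_iff.mp (Subgroup.mem_bot.mp (hbot ▸ (hmem h).mp hh)))
  · intro B hB hBA
    by_cases hb : B = ⊥
    · exact Or.inl hb
    refine Or.inr (le_antisymm hBA ?_)
    have hKH : B.comap hZ.powHom ≤ H := fun g hg => (hmem g).mpr (hBA hg)
    have hlt : Z < B.comap hZ.powHom := by
      obtain ⟨b, hbB, hb1⟩ := B.bot_or_exists_ne_one.resolve_left hb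
      obtain ⟨x, rfl⟩ := hZ.exists_pow_eq (hB.le hbB)
      refine SetLike.lt_iff_le_and_exists.mpr ⟨fun z hz => ?_, x, hbB, fun hx => ?_⟩
      · rw [Subgroup.mem_comap, hZ.powHom_apply, hZ.pow_eq_one_iff.mpr hz]
        exact B.one_mem
      · exact hb1 (hZ.pow_eq_one_iff.mpr hx)
    have hle := hH.2 ⟨(hZ.isPowerfullyEmbedded_iff hp _).mpr fun x hx g => ?_, hlt⟩ hKH
    · exact Subgroup.map_le_iff_le_comap.mpr hle
    · have hxg := hB.commutator_mem hx g
      obtain ⟨y, hy⟩ := hZ.exists_pow_eq (hB.le hxg)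
      exact ⟨y, show y ^ p ∈ B from hy ▸ hxg, hy⟩

/-- The subgroup `Z` is the internal direct product of finitely many conjugates of a minimal
power ideal under automorphisms. -/
theorem IsPowerUCS.exists_iSupIndep_map {p : ℕ} {G : Type*} [Group G] [Finite G] {Z A : Subgroup G}
    (hZ : IsPowerUCS p Z) (hA : IsMinimalPowerIdeal p Z A) :
    ∃ S : Set (MulAut G), (⨆ s : S, A.map s.1.toMonoidHom) = Z ∧
      iSupIndep fun s : S => A.map s.1.toMonoidHom := by
  have : Finite (MulAut G) := Finite.of_injective (fun φ : MulAut G => (φ : G → G)) DFunLike.coe_injective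
  have hfull : (⨆ s ∈ (Set.univ : Set (MulAut G)), A.map s.toMonoidHom) = Z := by
    have hc : (⨆ s ∈ (Set.univ : Set (MulAut G)), A.map s.toMonoidHom).Characteristic := by
      rw [Subgroup.characteristic_iff_map_le]
      intro φ
      simp only [Set.mem_univ, iSup_pos, Subgroup.map_iSup, Subgroup.map_map]
      refine iSup_le fun s => ?_
      exact le_iSup (fun s : MulAut G => A.map s.toMonoidHom) ((show MulAut G from φ) * s)
    have hle : (⨆ s ∈ (Set.univ : Set (MulAut G)), A.map s.toMonoidHom) ≤ Z :=
      iSup₂_le fun s _ => (hA.toIsPowerIdeal.map hZ.characteristic s).le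
    rcases hZ.char_cases hc with h | h | h
    · refine absurd (le_bot_iff.mp (h ▸ ?_)) hA.ne_bot
      intro a ha
      exact (le_iSup₂ (f := fun (s : MulAut G) (_ : s ∈ Set.univ) => A.map s.toMonoidHom)
        1 (Set.mem_univ _)) ⟨a, ha, rfl⟩
    · exact h
    · exact absurd (top_le_iff.mp (h ▸ hle)) hZ.ne_top
  obtain ⟨S, -, hS⟩ := (Set.toFinite
    {S : Set (MulAut G) | (⨆ s ∈ S, A.map s.toMonoidHom) = Z}).exists_le_minimal hfull
  refine ⟨S, (iSup_subtype' (f := fun (s : MulAut G) (_ : s ∈ S) => A.map s.toMonoidHom)).symm.trans hS.1, fun s => ?_⟩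
  have hid : ∀ s : MulAut G, IsPowerIdeal p Z (A.map s.toMonoidHom) := fun s =>
    hA.toIsPowerIdeal.map hZ.characteristic s
  have hR : IsPowerIdeal p Z (⨆ j, ⨆ (_ : j ≠ s), A.map (j : S).1.toMonoidHom) :=
    hZ.isPowerIdeal_iSup fun j => hZ.isPowerIdeal_iSup fun _ => hid _
  -- One image meets the sum of the others in an ideal. By minimality this is trivial or the whole
  -- image, and the latter would make `s` redundant in `S`.
  have hI := (hid s.1).inf hR
  have hback := hI.map hZ.characteristic (MulEquiv.symm s.1)
  rw [disjoint_iff]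
  by_contra hne
  have hcases := hA.eq_bot_or_eq hback (by
    rintro _ ⟨_, ⟨⟨a, ha, rfl⟩, -⟩, rfl⟩
    change (MulEquiv.symm s.1) (s.1 a) ∈ A
    rwa [MulEquiv.symm_apply_apply])
  rcases hcases with h | h
  · exact hne ((Subgroup.map_eq_bot_iff_of_injective _ (MulEquiv.symm s.1).injective).mp h)
  · have hsle : A.map s.1.toMonoidHom ≤ ⨆ j, ⨆ (_ : j ≠ s), A.map (j : S).1.toMonoidHom := by
      rintro _ ⟨a, ha, rfl⟩
      rw [← h] at ha
      obtain ⟨b, hb, rfl⟩ := ha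
      have : s.1.toMonoidHom ((MulEquiv.symm s.1).toMonoidHom b) = b :=
        MulEquiv.apply_symm_apply s.1 b
      rw [this]
      exact hb.2
    have hsle' : A.map s.1.toMonoidHom ≤ ⨆ t ∈ S \ {s.1}, A.map t.toMonoidHom :=
      hsle.trans (iSup₂_le fun j hj => le_iSup₂
        (f := fun (t : MulAut G) (_ : t ∈ S \ {s.1}) => A.map t.toMonoidHom) j.1
        ⟨j.2, fun h => hj (Subtype.ext h)⟩)
    have heq : (⨆ t ∈ S \ {s.1}, A.map t.toMonoidHom) = Z := by
      refine le_antisymm (iSup₂_le fun t _ => (hid t).le) (hS.1.ge.trans (iSup₂_le fun t ht => ?_))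
      by_cases hts : t = s.1
      · exact hts ▸ hsle'
      · exact le_iSup₂ (f := fun (t : MulAut G) (_ : t ∈ S \ {s.1}) => A.map t.toMonoidHom) t
          ⟨ht, hts⟩
    exact (hS.2 heq Set.sdiff_subset s.2).2 rfl

/-! ### Lifting A to a subgroup and decomposing G -/

/-- `H` is a subgroup of `G` which meets `Z` in `A` and whose `p`-th powers are precisely the
elements of `A`. -/
structure IsPowerSection (p : ℕ) {G : Type*} [Group G] (Z A H : Subgroup G) : Prop where
  le : A ≤ H
  pow_mem : ∀ {x}, x ∈ H → x ^ p ∈ A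
  mem_of_mem : ∀ {x}, x ∈ H → x ∈ Z → x ∈ A
  exists_pow_eq : ∀ {a}, a ∈ A → ∃ x ∈ H, x ^ p = a

/-- A maximal H with A ≤ H, H^p ≤ A and H ∩ Z ≤ A works. It is normal because [H, G] ≤ A. If g^p ∈ A
but g ∉ HZ, then H⟨g⟩ still qualifies: h g^i ∈ Z with p ∤ i would force g ∈ HZ. -/
theorem IsPowerUCS.exists_isPowerSection {p : ℕ} (hp : p.Prime) {G : Type*} [Group G] [Finite G]
    {Z A : Subgroup G} (hZ : IsPowerUCS p Z) (hA : IsPowerIdeal p Z A) :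
    ∃ H : Subgroup G, IsPowerSection p Z A H ∧
      ∀ g, g ^ p ∈ A → ∃ x ∈ H, ∃ c ∈ Z, x * c = g := by
  obtain ⟨H, -, ⟨hAH, hHA, hHZ⟩, hmax⟩ := (Set.toFinite {K : Subgroup G |
    A ≤ K ∧ (∀ x ∈ K, x ^ p ∈ A) ∧ ∀ x ∈ K, x ∈ Z → x ∈ A}).exists_le_maximal
    (a := A) ⟨le_rfl, fun x hx => A.pow_mem hx p, fun x hx _ => hx⟩
  have hnorm : H.Normal := ⟨fun x hx g => by
    have h := H.mul_mem (H.inv_mem (hAH (hA.commutator_mem (hHA x hx) g))) hx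
    have hc := hZ.commute (hZ.commutator_mem g x) x
    have : g * x * g⁻¹ = ⁅x, g⁆⁻¹ * x := by
      rw [commutatorElement_inv, commutatorElement_def]; group
    rwa [this]⟩
  have hsplit : ∀ g, g ^ p ∈ A → ∃ x ∈ H, ∃ c ∈ Z, x * c = g := by
    intro g hg
    by_contra hcon
    have hgHZ : g ∉ H ⊔ Z := fun h => hcon (Subgroup.mem_sup_of_normal_left.mp h)
    have hle : H ⊔ Subgroup.zpowers g ≤ H := by
      refine hmax ⟨hAH.trans le_sup_left, fun x hx => ?_, fun x hx hxZ => ?_⟩ le_sup_left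
      · obtain ⟨h, hh, _, ⟨i, rfl⟩, rfl⟩ := Subgroup.mem_sup_of_normal_left.mp hx
        rw [hZ.mul_pow]
        refine A.mul_mem (hHA h hh) ?_
        change (g ^ i) ^ p ∈ A
        rw [← zpow_natCast, ← zpow_mul, mul_comm, zpow_mul, zpow_natCast]
        exact A.zpow_mem hg i
      · obtain ⟨h, hh, _, ⟨i, rfl⟩, rfl⟩ := Subgroup.mem_sup_of_normal_left.mp hx
        change h * g ^ i ∈ Z at hxZ
        by_cases hi : (p : ℤ) ∣ i
        · obtain ⟨j, rfl⟩ := hi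
          have hgj : g ^ ((p : ℤ) * j) ∈ A := by
            rw [zpow_mul, zpow_natCast]; exact A.zpow_mem hg j
          have hhZ : h ∈ Z := (Z.mul_mem_cancel_right (hA.le hgj)).mp hxZ
          exact A.mul_mem (hHZ h hh hhZ) hgj
        · refine absurd ((H ⊔ Z).mem_of_pow_mem_of_coprime (x := g) (a := p) (b := i) ?_ ?_ ?_) hgHZ
          · rw [zpow_natCast]
            exact (le_sup_left : H ≤ H ⊔ Z) (hAH hg)
          · have h1 : g ^ i = h⁻¹ * (h * g ^ i) := by group
            rw [h1]
            exact Subgroup.mul_mem_sup (H.inv_mem hh) hxZ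
          · exact (Prime.coprime_iff_not_dvd (Nat.prime_iff_prime_int.mp hp)).mpr hi
    exact hgHZ ((le_sup_left : H ≤ H ⊔ Z)
      (hle ((le_sup_right : Subgroup.zpowers g ≤ _) (Subgroup.mem_zpowers g))))
  refine ⟨H, ⟨hAH, hHA _, hHZ _, fun {a} ha => ?_⟩, hsplit⟩
  obtain ⟨g, rfl⟩ := hZ.exists_pow_eq (hA.le ha)
  obtain ⟨x, hx, c, hc, rfl⟩ := hsplit g ha
  exact ⟨x, hx, by rw [hZ.mul_pow, hZ.pow_eq_one_iff.mpr hc, mul_one]⟩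

theorem IsPowerUCS.exists_mulEquiv_pi {p : ℕ} {G : Type*} [Group G] {Z A H : Subgroup G}
    (hZ : IsPowerUCS p Z) (hA : IsPowerIdeal p Z A) (hH : IsPowerSection p Z A H)
    {S : Set (MulAut G)} [Finite S] [DecidableEq S]
    (hS : (⨆ s : S, A.map s.1.toMonoidHom) = Z)
    (hind : iSupIndep fun s : S => A.map s.1.toMonoidHom) :
    ∃ e : (S → H) ≃* G, ∀ s h, e (Pi.mulSingle s h) = s.1 h := by
  have := Fintype.ofFinite S
  let φ : S → H →* G := fun s => s.1.toMonoidHom.comp H.subtype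
  have hφ : ∀ s h, φ s h = s.1 h := fun _ _ => rfl
  have hcomm : Pairwise fun s t => ∀ x y, Commute (φ s x) (φ t y) := by
    intro s t hst x y
    -- The commutator lies in two independent ideals, so it is trivial.
    have hs : ⁅φ s x, φ t y⁆ ∈ A.map s.1.toMonoidHom :=
      (hA.map hZ.characteristic s.1).commutator_mem
        ⟨x ^ p, hH.pow_mem x.2, map_pow s.1 (x : G) p⟩ _
    have ht : ⁅φ s x, φ t y⁆ ∈ A.map t.1.toMonoidHom := by
      rw [← commutatorElement_inv]
      exact Subgroup.inv_mem _ ((hA.map hZ.characteristic t.1).commutator_mem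
        ⟨y ^ p, hH.pow_mem y.2, map_pow t.1 (y : G) p⟩ _)
    exact commutatorElement_eq_one_iff_commute.mp
      (Subgroup.disjoint_def.mp (hind.pairwiseDisjoint hst) hs ht)
  let F : (S → H) →* G := MonoidHom.noncommPiCoprod φ hcomm
  have hF : ∀ s h, F (Pi.mulSingle s h) = s.1 h := fun s h =>
    MonoidHom.noncommPiCoprod_mulSingle φ s h
  have hone : ∀ f : S → H, (∀ s, (f s : G) ∈ A) → F f = 1 → f = 1 := by
    intro f hfA hf
    funext s
    have h1 := Subgroup.eq_one_of_noncommProd_eq_one_of_iSupIndep Finset.univ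
      (fun s => φ s (f s)) (fun _ _ _ _ h => hcomm h _ _) _ hind
      (fun s _ => ⟨f s, hfA s, rfl⟩) hf s (Finset.mem_univ s)
    exact Subtype.ext (s.1.injective (h1.trans (map_one s.1).symm))
  -- Independence is used twice: on the p-th power of a kernel element, which places its coordinates
  -- in A, and then on the element itself.
  have hinj : Function.Injective F := by
    refine (injective_iff_map_eq_one F).mpr fun f hf => hone f (fun s => ?_) hf
    have h1 : f ^ p = 1 := hone (f ^ p) (fun s => hH.pow_mem (f s).2) (by
      rw [map_pow, hf, one_pow])
    refine hH.mem_of_mem (f s).2 (hZ.pow_eq_one_iff.mp ?_)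
    exact congrArg Subtype.val (congrFun h1 s)
  have hsurj : Function.Surjective F := by
    -- Every p-th power in G is the p-th power of a value of `F`, so G is the range of `F` times Z;
    -- the range contains Z.
    have hroot : ∀ z ∈ ⨆ s : S, A.map s.1.toMonoidHom, ∃ f, F f ^ p = z := by
      intro z hz
      induction hz using Subgroup.iSup_induction' with
      | hp s z hz =>
        obtain ⟨a, ha, rfl⟩ := hz
        obtain ⟨x, hx, rfl⟩ := hH.exists_pow_eq ha
        exact ⟨Pi.mulSingle s ⟨x, hx⟩, by rw [hF]; exact (map_pow s.1 x p).symm⟩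
      | h1 => exact ⟨1, by simp⟩
      | hmul a b _ _ iha ihb =>
        obtain ⟨f, rfl⟩ := iha
        obtain ⟨g, rfl⟩ := ihb
        exact ⟨f * g, by rw [map_mul, hZ.mul_pow]⟩
    have hZF : Z ≤ F.range := by
      rw [← hS]
      refine iSup_le fun s => ?_
      rintro _ ⟨a, ha, rfl⟩
      exact ⟨Pi.mulSingle s ⟨a, hH.le ha⟩, hF _ _⟩
    intro g
    obtain ⟨f, hf⟩ := hroot (g ^ p) (hS ▸ hZ.pow_mem g)
    obtain ⟨c, hc, rfl⟩ := hZ.exists_eq_mul_of_pow_eq hf.symm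
    obtain ⟨f', rfl⟩ := hZF hc
    exact ⟨f * f', map_mul F f f'⟩
  exact ⟨MulEquiv.ofBijective F ⟨hinj, hsurj⟩, hF⟩

/-! ### The factor is UCS -/

section Retract

variable {p : ℕ} {G : Type*} [Group G] {Z A H : Subgroup G}

/-- Let K = f⁻¹(Z). Then K^p is an ideal: for z ∈ K write [z, x] = w^p; then f(w)^p = [f z, f(π x)]
= 1, so w ∈ K. The retraction π replaces x ∈ G by an element of H. By minimality K^p is trivial,
making f injective, or equals A, making K = H. -/
theorem IsPowerUCS.bijective_or_forall_mem [Finite G] (hZ : IsPowerUCS p Z)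
    (hA : IsMinimalPowerIdeal p Z A) (hH : IsPowerSection p Z A H) (π : G →* H)
    (hπ : ∀ h : H, π h = h) (f : H →* H) :
    Function.Bijective f ∨ ∀ x, (f x : G) ∈ Z := by
  let K : Subgroup H := Z.comap (H.subtype.comp f)
  have hK : ∀ x, x ∈ K ↔ (f x : G) ∈ Z := fun _ => Iff.rfl
  have hKA : ∀ a : H, (a : G) ∈ A → a ∈ K := by
    intro a ha
    obtain ⟨x, hx, hxa⟩ := hH.exists_pow_eq ha
    have : a = (⟨x, hx⟩ : H) ^ p := Subtype.ext hxa.symm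
    rw [hK, this, map_pow]
    exact hZ.pow_mem _
  have hKp : ∀ w : H, f (w ^ p) = 1 → w ∈ K := by
    intro w hw
    rw [hK, ← hZ.pow_eq_one_iff, ← Subgroup.coe_pow, ← map_pow, hw, Subgroup.coe_one]
  have hB : IsPowerIdeal p Z ((K.map H.subtype).map hZ.powHom) := by
    refine ⟨?_, fun {g} hg x => ?_⟩
    · rintro _ ⟨y, -, rfl⟩
      exact hZ.pow_mem y
    · obtain ⟨_, ⟨z, hz, rfl⟩, hzg⟩ := hg
      obtain ⟨c, hc, rfl⟩ := hZ.exists_eq_mul_of_pow_eq (x := g) (y := z) hzg.symm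
      rw [hZ.commutatorElement_mul_mem hc]
      have hzx : ⁅(z : G), x⁆ ∈ A := hA.commutator_mem (hH.pow_mem z.2) x
      obtain ⟨w, hw, hwz⟩ := hH.exists_pow_eq hzx
      refine ⟨w, ⟨⟨w, hw⟩, hKp _ ?_, rfl⟩, hwz⟩
      have h1 : (⟨w, hw⟩ : H) ^ p = ⁅z, π x⁆ := by
        rw [← hπ (⟨w, hw⟩ ^ p)]
        simp only [SubmonoidClass.coe_pow, hwz, map_commutatorElement, hπ]
      rw [h1, map_commutatorElement]
      exact Subtype.ext (hZ.commutatorElement_eq_one hz _)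
  have hBA : (K.map H.subtype).map hZ.powHom ≤ A := by
    rintro _ ⟨_, ⟨y, -, rfl⟩, rfl⟩
    exact hH.pow_mem y.2
  rcases hA.eq_bot_or_eq hB hBA with h | h
  · left
    refine Finite.injective_iff_bijective.mp ((injective_iff_map_eq_one f).mpr fun x hx => ?_)
    have hKZ : ∀ y ∈ K, (y : G) ∈ Z := fun y hy => by
      refine hZ.pow_eq_one_iff.mp (Subgroup.mem_bot.mp ?_)
      rw [← h]
      exact ⟨y, ⟨y, hy, rfl⟩, rfl⟩
    have hxK : x ∈ K := by rw [hK, hx]; exact Z.one_mem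
    obtain ⟨y, hy, hyx⟩ := hH.exists_pow_eq (hH.mem_of_mem x.2 (hKZ x hxK))
    have hxy : x = (⟨y, hy⟩ : H) ^ p := Subtype.ext hyx.symm
    have hyK : (⟨y, hy⟩ : H) ∈ K := hKp _ (hxy ▸ hx)
    exact Subtype.ext (hyx.symm.trans (hZ.pow_eq_one_iff.mpr (hKZ _ hyK)))
  · right
    intro x
    have hx : (x : G) ^ p ∈ A := hH.pow_mem x.2
    rw [← h] at hx
    obtain ⟨_, ⟨y, hy, rfl⟩, hyx⟩ := hx
    obtain ⟨c, hc, hxc⟩ := hZ.exists_eq_mul_of_pow_eq (x := x) (y := y) hyx.symm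
    have hcH : c ∈ H := by
      rw [← inv_mul_eq_iff_eq_mul.mpr hxc]
      exact H.mul_mem (H.inv_mem y.2) x.2
    have hx' : x = y * ⟨c, hcH⟩ := Subtype.ext hxc
    exact (hK x).mp (hx' ▸ K.mul_mem hy (hKA _ (hH.mem_of_mem hcH hc)))

/-- The Aut(G)-images of M generate G. Under π each lands in M or in Z by the dichotomy, so H = M(H
∩ Z). Taking p-th powers, H ∩ Z = A = H^p ≤ M. -/
theorem IsPowerUCS.eq_top_of_characteristic [Finite G] (hZ : IsPowerUCS p Z)
    (hA : IsMinimalPowerIdeal p Z A) (hH : IsPowerSection p Z A H) (π : G →* H)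
    (hπ : ∀ h : H, π h = h) {M : Subgroup H} (hM : M.Characteristic) {m : H} (hm : m ∈ M)
    (hmZ : (m : G) ∉ Z) : M = ⊤ := by
  have hc : (⨆ s : MulAut G, (M.map H.subtype).map s.toMonoidHom).Characteristic := by
    rw [Subgroup.characteristic_iff_map_le]
    intro φ
    rw [Subgroup.map_iSup]
    refine iSup_le fun s => ?_
    rw [Subgroup.map_map]
    exact le_iSup (fun s : MulAut G => (M.map H.subtype).map s.toMonoidHom)
      ((show MulAut G from φ) * s)
  have hmX : (m : G) ∈ ⨆ s : MulAut G, (M.map H.subtype).map s.toMonoidHom :=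
    Subgroup.mem_iSup_of_mem 1 ⟨m, ⟨m, hm, rfl⟩, rfl⟩
  have htop : (⨆ s : MulAut G, (M.map H.subtype).map s.toMonoidHom) = ⊤ := by
    rcases hZ.char_cases hc with h | h | h
    · rw [h] at hmX
      exact absurd (Subgroup.mem_bot.mp hmX ▸ Z.one_mem) hmZ
    · exact absurd (h ▸ hmX) hmZ
    · exact h
  have hgen : ∀ g : G, ∃ m ∈ M, ∃ c : H, (c : G) ∈ Z ∧ π g = m * c := by
    intro g
    have hg : g ∈ ⨆ s : MulAut G, (M.map H.subtype).map s.toMonoidHom := htop ▸ Subgroup.mem_top g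
    induction hg using Subgroup.iSup_induction' with
    | hp s x hx =>
      obtain ⟨_, ⟨y, hy, rfl⟩, rfl⟩ := hx
      rcases hZ.bijective_or_forall_mem hA hH π hπ
        (π.comp (s.toMonoidHom.comp H.subtype)) with hf | hf
      · exact ⟨_, hM.apply_mem (MulEquiv.ofBijective _ hf) hy, 1, Z.one_mem, (mul_one _).symm⟩
      · exact ⟨1, M.one_mem, _, hf y, (one_mul _).symm⟩
    | h1 => exact ⟨1, M.one_mem, 1, Z.one_mem, by simp⟩
    | hmul a b _ _ iha ihb =>
      obtain ⟨m, hm, c, hc, h⟩ := iha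
      obtain ⟨n, hn, d, hd, h'⟩ := ihb
      refine ⟨m * n, M.mul_mem hm hn, c * d, Z.mul_mem hc hd, ?_⟩
      have hcn : c * n = n * c := Subtype.ext (hZ.commute hc n)
      rw [map_mul, h, h', mul_assoc, ← mul_assoc c, hcn]
      simp only [mul_assoc]
  have hpow : ∀ h : H, h ^ p ∈ M := by
    intro h
    obtain ⟨m, hm, c, hc, hmc⟩ := hgen h
    have : h ^ p = m ^ p := by
      rw [← hπ h, hmc]
      refine Subtype.ext ?_
      change ((m : G) * c) ^ p = (m : G) ^ p
      rw [hZ.mul_pow, hZ.pow_eq_one_iff.mpr hc, mul_one]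
    exact this ▸ M.pow_mem hm p
  refine (Subgroup.eq_top_iff' M).mpr fun h => ?_
  obtain ⟨m, hm, c, hc, hmc⟩ := hgen h
  obtain ⟨x, hx, hxc⟩ := hH.exists_pow_eq (hH.mem_of_mem c.2 hc)
  rw [← hπ h, hmc]
  have : c = (⟨x, hx⟩ : H) ^ p := Subtype.ext hxc.symm
  exact M.mul_mem hm (this ▸ hpow _)

theorem IsPowerUCS.isUCS_of_retract [Finite G] (hZ : IsPowerUCS p Z)
    (hA : IsMinimalPowerIdeal p Z A) (hH : IsPowerSection p Z A H) (π : G →* H)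
    (hπ : ∀ h : H, π h = h) : IsUCS H := by
  have hmemA : ∀ x : H, (x : G) ∈ A ↔ x ^ p = 1 := by
    intro x
    rw [← Subtype.coe_inj, Subgroup.coe_pow, Subgroup.coe_one, hZ.pow_eq_one_iff]
    exact ⟨fun h => hA.le h, hH.mem_of_mem x.2⟩
  have hmulpow : ∀ x y : H, (x * y) ^ p = x ^ p * y ^ p := fun x y =>
    Subtype.ext (hZ.mul_pow x y)
  obtain ⟨a, haA, ha1⟩ := A.bot_or_exists_ne_one.resolve_left hA.ne_bot
  refine ⟨A.subgroupOf H, ⟨?_, ?_, ?_⟩, ?_⟩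
  · refine Subgroup.characteristic_of_forall_mem fun φ x hx => ?_
    rw [Subgroup.mem_subgroupOf, hmemA] at hx ⊢
    rw [← map_pow, hx, map_one]
  · intro h
    have : (⟨a, hH.le haA⟩ : H) ∈ A.subgroupOf H := haA
    rw [h, Subgroup.mem_bot] at this
    exact ha1 (congrArg Subtype.val this)
  · intro h
    obtain ⟨x, hx, rfl⟩ := hH.exists_pow_eq haA
    have : (⟨x, hx⟩ : H) ∈ A.subgroupOf H := h ▸ Subgroup.mem_top _
    exact ha1 (congrArg Subtype.val ((hmemA ⟨x, hx⟩).mp this))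
  · rintro M ⟨hM, hMb, hMt⟩
    have hMZ : ∀ m ∈ M, (m : G) ∈ Z := fun m hm => by
      by_contra hmZ
      exact hMt (hZ.eq_top_of_characteristic hA hH π hπ hM hm hmZ)
    refine le_antisymm (fun m hm => hH.mem_of_mem m.2 (hMZ m hm)) ?_
    obtain ⟨m, hm, hm1⟩ := M.bot_or_exists_ne_one.resolve_left hMb
    obtain ⟨x, hx, hxm⟩ := hH.exists_pow_eq (hH.mem_of_mem m.2 (hMZ m hm))
    have hxm' : (⟨x, hx⟩ : H) ^ p = m := Subtype.ext hxm
    -- The preimage of M under the power map is characteristic and not inside Z, so it is all of H,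
    -- whence A = H^p ≤ M.
    have hR : (M.comap (MonoidHom.mk' (fun x : H => x ^ p) hmulpow)).Characteristic :=
      Subgroup.characteristic_of_forall_mem fun φ y hy => by
        change φ y ^ p ∈ M
        rw [← map_pow]
        exact hM.apply_mem φ hy
    have htop := hZ.eq_top_of_characteristic hA hH π hπ hR (m := ⟨x, hx⟩)
      (show (⟨x, hx⟩ : H) ^ p ∈ M from hxm' ▸ hm)
      (fun h => hm1 (Subtype.ext (hxm.symm.trans (hZ.pow_eq_one_iff.mpr h))))
    intro b hb
    obtain ⟨y, hy, hyb⟩ := hH.exists_pow_eq hb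
    have hyb' : (⟨y, hy⟩ : H) ^ p = b := Subtype.ext hyb
    have hyR : (⟨y, hy⟩ : H) ^ p ∈ M := (htop.ge (Subgroup.mem_top (⟨y, hy⟩ : H)) :)
    exact hyb' ▸ hyR

end Retract

/-! ### Assembling the direct power -/

theorem Monoid.exponent_eq_of_mulEquiv_pi {ι G H : Type*} [Nonempty ι] [Group G] [Group H]
    (e : (ι → H) ≃* G) : Monoid.exponent H = Monoid.exponent G := by
  classical
  refine Nat.dvd_antisymm ?_ ?_
  · refine Monoid.exponent_dvd_of_monoidHom
      (e.toMonoidHom.comp (MonoidHom.mulSingle (fun _ : ι => H) (Classical.arbitrary ι))) ?_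
    exact e.injective.comp (Pi.mulSingle_injective (M := fun _ : ι => H) (Classical.arbitrary ι))
  · refine Monoid.exponent_dvd_of_forall_pow_eq_one fun g => e.symm.injective ?_
    rw [map_pow, map_one]
    exact funext fun i => Monoid.pow_exponent_eq_one _

theorem mainTheorem8 (p : ℕ) (hp : p.Prime) (hodd : Odd p)
    (G : Type*) [Group G] [Finite G] (hpG : IsPGroup p G)
    (hG : IsUCS G) (hexp : Monoid.exponent G = p ^ 2) :
    (∃ H : Subgroup G,
      Minimal (fun K : Subgroup G => IsPowerfullyEmbedded p K ∧ frattini G < K) H) ∧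
    ∀ H : Subgroup G,
      Minimal (fun K : Subgroup G => IsPowerfullyEmbedded p K ∧ frattini G < K) H →
      ∃ H₀ : Subgroup G,
        IsUCS H₀ ∧ Monoid.exponent H₀ = p ^ 2 ∧
        (∃ k : ℕ, 1 ≤ k ∧ ∃ e : (Fin k → H₀) ≃* G, ∃ i : Fin k,
          ∀ h : H₀, e (Pi.mulSingle i h) = h) ∧
        (H₀ : Set G) * (frattini G : Set G) = (H : Set G) := by
  classical
  have hZ : IsPowerUCS p (frattini G) := hG.isPowerUCS_frattini hp hodd hpG hexp
  have hp2 : p ≠ 2 := by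
    rintro rfl
    exact absurd hodd (by decide)
  refine ⟨?_, fun H hH => ?_⟩
  · obtain ⟨H, -, hH⟩ := (Set.toFinite
      {K : Subgroup G | IsPowerfullyEmbedded p K ∧ frattini G < K}).exists_le_minimal (a := ⊤)
      ⟨hZ.isPowerfullyEmbedded_top hp2, lt_top_iff_ne_top.mpr hZ.ne_top⟩
    exact ⟨H, hH⟩
  obtain ⟨A, hA, hHA⟩ := hZ.exists_isMinimalPowerIdeal hp2 hH
  obtain ⟨H₀, hH₀, hsplit⟩ := hZ.exists_isPowerSection hp hA.toIsPowerIdeal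
  obtain ⟨S, hS, hind⟩ := hZ.exists_iSupIndep_map hA
  have : Finite (MulAut G) :=
    Finite.of_injective (fun φ : MulAut G => (φ : G → G)) DFunLike.coe_injective
  obtain ⟨e, he⟩ := hZ.exists_mulEquiv_pi hA.toIsPowerIdeal hH₀ hS hind
  have hne : Nonempty S := by
    by_contra h
    rw [not_nonempty_iff] at h
    exact hZ.ne_bot (hS.symm.trans (iSup_of_empty _))
  obtain ⟨s⟩ := id hne
  -- Coordinate `s` is embedded through the automorphism `s`; composing with its inverse makes that
  -- embedding the inclusion of `H₀`.
  let e' : (S → H₀) ≃* G := e.trans (MulEquiv.symm s.1)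
  have he' : ∀ h : H₀, e' (Pi.mulSingle s h) = h := fun h => by
    change MulEquiv.symm s.1 (e (Pi.mulSingle s h)) = h
    rw [he, MulEquiv.symm_apply_apply]
  let σ : Fin (Nat.card S) ≃ S := (Finite.equivFin S).symm
  refine ⟨H₀, ?_, ?_, ⟨Nat.card S, Nat.card_pos, ?_⟩, ?_⟩
  · refine hZ.isUCS_of_retract hA hH₀
      ((Pi.evalMonoidHom (fun _ : S => H₀) s).comp e'.symm.toMonoidHom) fun h => ?_
    change e'.symm h s = h
    rw [← he' h, MulEquiv.symm_apply_apply, Pi.mulSingle_eq_same]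
  · rw [Monoid.exponent_eq_of_mulEquiv_pi e', hexp]
  · refine ⟨(MulEquiv.arrowCongr σ (MulEquiv.refl H₀)).trans e', σ.symm s, fun h => ?_⟩
    rw [MulEquiv.trans_apply, ← he' h]
    congr 1
    funext t
    change (Pi.mulSingle (σ.symm s) h : Fin (Nat.card S) → H₀) (σ.symm t) = _
    simp only [Pi.mulSingle_apply, σ.symm.injective.eq_iff]
  · ext g
    rw [Set.mem_mul, SetLike.mem_coe, hHA]
    constructor
    · rintro ⟨x, hx, c, hc, rfl⟩
      rw [hZ.mul_pow, hZ.pow_eq_one_iff.mpr hc, mul_one]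
      exact hH₀.pow_mem hx
    · exact hsplit g
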